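/- **Setting (SPSC).** Let $S$ (services), $V$ (nodes), $U$ (users) be finite sets. Service $i$ has size $s_i>0$, node $j$ has capacity $c_j\ge 0$, and user $k$ has a required service $u_k\in S$, a set of nodes $T_k\subseteq V$ and a reward $w_k\ge 0$. A placement is a family $X=(X_i)_{i\in S}$ with $X_i\subseteq V$. It is feasible if $\sum_{i:\,j\in X_i}s_i\le c_j$ for all $j\in V$, and its total reward is $\sum_{k:\,T_k\cap X_{u_k}\neq\emptyset}w_k$. Let $R$ be the maximum total reward of a feasible placement. **Algorithm SA2.** All quotients $0/0$ are read as $0$. *Step 1 (LP).* Take an optimal solution $(x,r)$ of: maximize $\sum_k r_kw_k$ subject to $0\le r_k\le 1$, $r_k\le\sum_{j\in T_k}x_{u_kj}$, $\sum_i x_{ij}s_i\le c_j$, $0\le x_{ij}\le 1$, and $x_{ij}=0$ whenever $s_i>c_j$. For $j\in V$ and integers $q\ge 1$ put $P_{j,\oplus}=\{i:\frac12c_j<s_i\le c_j\}$, $P_{j,\ominus}=\{i:\frac14c_j<s_i\le\frac12c_j\}$, $P_{j,q}=\{i:2^{-q}c_j/4<s_i\le 2^{-(q-1)}c_j/4\}$.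 For every class $q\in\{\oplus,\ominus,1,2,\dots\}$ put $D_{j,q}=\sum_{i\in P_{j,q}}x_{ij}$. For integers $q\ge1$ put $N_{j,q}=\lceil v_jD_{j,q}\rceil$, where $v_j=\frac{c_j/4}{\sum_{i:\,s_i\le c_j/4}s_ix_{ij}}$ (if this denominator is $0$, all $D_{j,q}$ with $q\ge 1$ vanish and $N_{j,q}=0$). Put $\mu_j=D_{j,\ominus}$ if $D_{j,\ominus}<2$, and $\mu_j=D_{j,\ominus}/2$ otherwise. *Step 2 (slot creation).* For a label $a\in\{1,2,3\}$ define $\pi_{ij}(a)$ as follows, with $\pi_{ij}(a)=0$ in all cases not listed: $\pi_{ij}(1)=x_{ij}/D_{j,\oplus}$ if $i\in P_{j,\oplus}$; $\pi_{ij}(2)=1-(1-x_{ij}/D_{j,\ominus})^2$ if $i\in P_{j,\ominus}$; $\pi_{ij}(3)=1-(1-x_{ij}/D_{j,q})^{N_{j,q}}$ if $i\in P_{j,q}$ for an integer $q\ge 1$. For an unlabelled node put $$\pi_{ij}(\emptyset)=\tfrac14D_{j,\oplus}\,\pi_{ij}(1)+\tfrac14\mu_j\,\pi_{ij}(2)+\bigl(1-\tfrac14D_{j,\oplus}-\tfrac14\mu_j\bigr)\pi_{ij}(3).$$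 Start with all nodes unlabelled. Go through the nodes in any order, and give each one a label for which $\sum_kw_k\bigl(1-\prod_{j\in T_k}(1-\pi_{u_kj}(\zeta(j)))\bigr)$ is largest, where $\zeta$ is the resulting partial labelling. At the end, create on each node $j$: one slot of class $\oplus$ if $j$ has label $1$; two slots of class $\ominus$ if it has label $2$; and, if it has label $3$, $N_{j,q}$ slots of class $q$ for every integer $q\ge 1$ with $P_{j,q}\ne\emptyset$. Let $\Lambda$ be the set of slots created. *Step 3 (service placement).* A partial slot allocation $\tau$ marks each slot $\sigma\in\Lambda$, of class $q$ on node $j$, as empty or assigns to it a service of $P_{j,q}$. Put $f_k(\tau)=1$ if some slot on a node of $T_k$ holds $u_k$. Otherwise put $f_k(\tau)=1-\prod(1-x_{u_kj}/D_{j,q})$, the product over the empty slots (of class $q$ on node $j$) with $j\in T_k$ and $u_k\in P_{j,q}$. Start with all slots empty. Go through the slots in any order, and assign to each one a service $i\in P_{j,q}$ for which $\sum_kw_kf_k$ of the resulting allocation is largest (the slot stays empty if $P_{j,q}=\emptyset$). The output is the placement $X$ in which $j\in X_i$ iff some slot on $j$ holds $i$. **Theorem.** For arbitrary service sizes and node capacities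 as above, SA2 produces an output. Whatever optimal LP solution, orders of nodes and slots, and maximizers are chosen, every output of SA2 is a feasible placement with total reward at least $\frac{1-e^{-1}}{4}\,R$. -/

import Mathlib

/-- An instance of Service Placement with Set Constraints, with services `S`, nodes `V`, users `U`.
User `k` requires `service k`, and gives reward `weight k` as soon as that service is placed on
some node of `nodes k`. -/
structure SPSC (S V U : Type*) where
  size : S → ℝ
  cap : V → ℝ
  service : U → S
  nodes : U → Finset V
  weight : U → ℝ
  size_pos : ∀ i, 0 < size i
  cap_nonneg : ∀ j, 0 ≤ cap j
  weight_nonneg : ∀ k, 0 ≤ weight k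

/-- The classes of slots: `large` is `⊕`, `medium` is `⊖`, and `small q` is the class `q`, for
`q` a positive natural number. -/
inductive SlotClass
  | large
  | medium
  | small (q : ℕ+)
  deriving DecidableEq

/-- The labels `1`, `2`, `3` of the nodes. -/
inductive NodeLabel
  | one
  | two
  | three
  deriving DecidableEq

/-- A slot: its node, its class, and a number telling apart slots with the same node and class. -/
abbrev Slot (V : Type*) := V × SlotClass × ℕ

namespace SPSC

/-- The parameter `β` of SA2. -/
noncomputable abbrev beta : ℝ := 1 / 4

/-- The parameter `γ = 1 - √β` of SA2. -/
noncomputable abbrev gamma : ℝ := 1 / 2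

/-- The parameter `δ = (1 - √β)²` of SA2. -/
noncomputable abbrev delta : ℝ := 1 / 4

section Problem

variable {S V U : Type*} [Fintype S] [Fintype V] [Fintype U] [DecidableEq V]
variable (I : SPSC S V U)

/-- A service placement `X` maps a service to the set of nodes it is placed on. It is feasible if
on every node the total size of the services placed there is at most the capacity. -/
def Feasible (X : S → Finset V) : Prop :=
  ∀ j, ∑ i, (if j ∈ X i then I.size i else 0) ≤ I.cap j

/-- The total reward of a service placement. -/
noncomputable def reward (X : S → Finset V) : ℝ :=
  ∑ k, if (I.nodes k ∩ X (I.service k)).Nonempty then I.weight k else 0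

/-- The largest total reward of a feasible service placement. -/
noncomputable def optimum : ℝ := sSup (I.reward '' {X | I.Feasible X})

/-- The supremum is a maximum. -/
theorem isGreatest_optimum : IsGreatest (I.reward '' {X | I.Feasible X}) I.optimum := by
  have hfin : (I.reward '' {X | I.Feasible X}).Finite := (Set.toFinite _).image _
  have hne : (I.reward '' {X | I.Feasible X}).Nonempty :=
    ⟨_, fun _ => ∅, fun j => by simpa using I.cap_nonneg j, rfl⟩
  exact ⟨hne.csSup_mem hfin, fun _ h => le_csSup hfin.bddAbove h⟩

end Problem

section Classes

variable {S V U : Type*} [Fintype S] (I : SPSC S V U)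

/-- The services that fit a slot of a given class on node `j`. -/
noncomputable def fits (j : V) : SlotClass → Finset S
  | .large => {i | 1 / 2 * I.cap j < I.size i ∧ I.size i ≤ I.cap j}
  | .medium => {i | I.cap j * beta < I.size i ∧ I.size i ≤ 1 / 2 * I.cap j}
  | .small q => {i | gamma ^ (q : ℕ) * I.cap j * beta < I.size i ∧
      I.size i ≤ gamma ^ ((q : ℕ) - 1) * I.cap j * beta}

theorem finite_small (j : V) : {q : ℕ+ | (I.fits j (.small q)).Nonempty}.Finite := by
  have h : {q : ℕ+ | (I.fits j (.small q)).Nonempty} =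
      ⋃ i : S, {q : ℕ+ | i ∈ I.fits j (.small q)} := by
    ext q; simp [Finset.Nonempty]
  rw [h]
  refine Set.finite_iUnion fun i => Set.Subsingleton.finite ?_
  have key : ∀ a b : ℕ+, a < b → i ∈ I.fits j (.small a) → i ∈ I.fits j (.small b) → False := by
    intro a b hab ha hb
    simp only [fits, Finset.mem_filter, Finset.mem_univ, true_and] at ha hb
    have h1 : gamma ^ ((b : ℕ) - 1) ≤ gamma ^ (a : ℕ) :=
      pow_le_pow_of_le_one (by norm_num [gamma]) (by norm_num [gamma])
        (Nat.le_sub_one_of_lt (by exact_mod_cast hab))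
    have h2 : gamma ^ ((b : ℕ) - 1) * I.cap j * beta ≤ gamma ^ (a : ℕ) * I.cap j * beta :=
      mul_le_mul_of_nonneg_right (mul_le_mul_of_nonneg_right h1 (I.cap_nonneg j))
        (by norm_num [beta])
    linarith [ha.1, hb.2]
  intro a ha b hb
  rcases lt_trichotomy a b with h | h | h
  · exact (key a b h ha hb).elim
  · exact h
  · exact (key b a h hb ha).elim

end Classes

section Defs

variable {S V U : Type*} [Fintype S] [Fintype V] [Fintype U] [DecidableEq S] [DecidableEq V]
variable (I : SPSC S V U)

/-! ### The linear programming step -/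

/-- The constraints of the linear program. -/
structure LPFeasible (x : S → V → ℝ) (r : U → ℝ) : Prop where
  r_nonneg : ∀ k, 0 ≤ r k
  r_le_sum : ∀ k, r k ≤ ∑ j ∈ I.nodes k, x (I.service k) j
  r_le_one : ∀ k, r k ≤ 1
  cap : ∀ j, ∑ i, x i j * I.size i ≤ I.cap j
  eq_zero : ∀ i j, I.cap j < I.size i → x i j = 0
  x_nonneg : ∀ i j, 0 ≤ x i j
  x_le_one : ∀ i j, x i j ≤ 1

/-- `(x, r)` is an optimal solution of the linear program. -/
def LPOptimal (x : S → V → ℝ) (r : U → ℝ) : Prop :=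
  I.LPFeasible x r ∧
    ∀ x' r', I.LPFeasible x' r' → ∑ k, r' k * I.weight k ≤ ∑ k, r k * I.weight k

/-! ### Slots -/

/-- The `q` for which some service fits the slots of class `q` on node `j`. -/
noncomputable def smallClasses (j : V) : Finset ℕ+ := (I.finite_small j).toFinset

/-- The total LP value on node `j` of the services that fit a class. -/
noncomputable def mass (x : S → V → ℝ) (j : V) (c : SlotClass) : ℝ := ∑ i ∈ I.fits j c, x i j

/-- The scaling factor of node `j` in the number of small slots. If the denominator is `0`, then
so are the masses of all small classes of `j`, and the factor is irrelevant. -/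
noncomputable def scale (x : S → V → ℝ) (j : V) : ℝ :=
  delta * I.cap j / ∑ i with I.size i ≤ I.cap j * beta, I.size i * x i j

/-- The number of slots of class `q` on a node `j` with label `3`. -/
noncomputable def smallCount (x : S → V → ℝ) (j : V) (q : ℕ+) : ℕ :=
  ⌈I.scale x j * I.mass x j (.small q)⌉₊

/-- `mass ⊖` if this is less than `2`, and half of it otherwise. -/
noncomputable def mediumWeight (x : S → V → ℝ) (j : V) : ℝ :=
  if I.mass x j .medium < 2 then I.mass x j .medium else I.mass x j .medium / 2

/-- The set of slots created from a labelling of the nodes. -/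
noncomputable def slots (x : S → V → ℝ) (lam : V → NodeLabel) : Finset (Slot V) :=
  Finset.univ.biUnion fun j =>
    match lam j with
    | .one => {(j, .large, 0)}
    | .two => {(j, .medium, 0), (j, .medium, 1)}
    | .three => (I.smallClasses j).biUnion fun q =>
        (Finset.range (I.smallCount x j q)).image fun t => (j, .small q, t)

/-! ### Labelling the nodes -/

/-- The probability computed for "service `i` is placed on node `j`", given the label of `j`
(quotients `0 / 0` are `0`). In the last case, at most one `q` has `i ∈ fits j (small q)`. -/
noncomputable def placeProb (x : S → V → ℝ) (i : S) (j : V) : NodeLabel → ℝ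
  | .one => if i ∈ I.fits j .large then x i j / I.mass x j .large else 0
  | .two => if i ∈ I.fits j .medium then 1 - (1 - x i j / I.mass x j .medium) ^ 2 else 0
  | .three => ∑ q ∈ I.smallClasses j, if i ∈ I.fits j (.small q) then
      1 - (1 - x i j / I.mass x j (.small q)) ^ I.smallCount x j q else 0

/-- The same for a node that may be unlabelled (`none`). -/
noncomputable def placeProbPartial (x : S → V → ℝ) (i : S) (j : V) : Option NodeLabel → ℝ
  | some a => I.placeProb x i j a
  | none => delta * I.mass x j .large * I.placeProb x i j .one
      + delta * I.mediumWeight x j * I.placeProb x i j .two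
      + (1 - delta * I.mass x j .large - delta * I.mediumWeight x j) * I.placeProb x i j .three

/-- The objective that guides the labelling, evaluated at a partial labelling. -/
noncomputable def labelValue (x : S → V → ℝ) (z : V → Option NodeLabel) : ℝ :=
  ∑ k, (1 - ∏ j ∈ I.nodes k, (1 - I.placeProbPartial x (I.service k) j (z j))) * I.weight k

/-- `LabelRun x l z z'`: starting from the partial labelling `z` and going once through the nodes
in the list `l`, giving each of them a label that maximizes `labelValue`, one can end with `z'`. -/
inductive LabelRun (x : S → V → ℝ) :
    List V → (V → Option NodeLabel) → (V → Option NodeLabel) → Prop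
  | nil (z : V → Option NodeLabel) : LabelRun x [] z z
  | cons {j : V} {l : List V} {z z' : V → Option NodeLabel} (a : NodeLabel)
      (hmax : ∀ b, I.labelValue x (Function.update z j (some b)) ≤
        I.labelValue x (Function.update z j (some a)))
      (hrest : LabelRun x l (Function.update z j (some a)) z') : LabelRun x (j :: l) z z'

/-! ### Placing the services -/

/-- The probability computed for "user `k` is satisfied", given the partial slot allocation `t`
on the set `L` of slots (quotients `0 / 0` are `0`). -/
noncomputable def satProb (x : S → V → ℝ) (L : Finset (Slot V)) (t : Slot V → Option S) (k : U) :
    ℝ :=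
  if ∃ s ∈ L, s.1 ∈ I.nodes k ∧ t s = some (I.service k) then 1
  else 1 - ∏ s ∈ L with s.1 ∈ I.nodes k ∧ t s = none ∧ I.service k ∈ I.fits s.1 s.2.1,
    (1 - x (I.service k) s.1 / I.mass x s.1 s.2.1)

/-- The objective that guides the placement, evaluated at a partial slot allocation. -/
noncomputable def slotValue (x : S → V → ℝ) (L : Finset (Slot V)) (t : Slot V → Option S) : ℝ :=
  ∑ k, I.satProb x L t k * I.weight k

/-- `PlaceRun x L l t t'`: starting from the partial slot allocation `t` and going once through
the slots in the list `l`, putting into each of them a fitting service that maximizes `slotValue`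
(and leaving it empty if no service fits), one can end with `t'`. -/
inductive PlaceRun (x : S → V → ℝ) (L : Finset (Slot V)) :
    List (Slot V) → (Slot V → Option S) → (Slot V → Option S) → Prop
  | nil (t : Slot V → Option S) : PlaceRun x L [] t t
  | skip {s : Slot V} {l : List (Slot V)} {t t' : Slot V → Option S}
      (hempty : I.fits s.1 s.2.1 = ∅) (hrest : PlaceRun x L l t t') : PlaceRun x L (s :: l) t t'
  | fill {s : Slot V} {l : List (Slot V)} {t t' : Slot V → Option S} (i : S)
      (hi : i ∈ I.fits s.1 s.2.1)
      (hmax : ∀ i' ∈ I.fits s.1 s.2.1, I.slotValue x L (Function.update t s (some i')) ≤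
        I.slotValue x L (Function.update t s (some i)))
      (hrest : PlaceRun x L l (Function.update t s (some i)) t') : PlaceRun x L (s :: l) t t'

/-- The service placement of a slot allocation: service `i` is placed on the nodes that have a
slot containing `i`. -/
def placementOf (L : Finset (Slot V)) (t : Slot V → Option S) (i : S) : Finset V :=
  {s ∈ L | t s = some i}.image Prod.fst

/-- `X` is an output of SA2: it arises from some optimal solution of the linear program, some
order in which the nodes are labelled, some order in which the slots are filled, and some choice
of the maximizers. -/
def IsSA2Output (X : S → Finset V) : Prop :=
  ∃ (x : S → V → ℝ) (r : U → ℝ) (nodeOrder : List V) (lam : V → NodeLabel)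
    (slotOrder : List (Slot V)) (psi : Slot V → Option S),
    I.LPOptimal x r ∧
    nodeOrder.Nodup ∧ (∀ j, j ∈ nodeOrder) ∧
    I.LabelRun x nodeOrder (fun _ => none) (fun j => some (lam j)) ∧
    slotOrder.Nodup ∧ (∀ s, s ∈ slotOrder ↔ s ∈ I.slots x lam) ∧
    I.PlaceRun x (I.slots x lam) slotOrder (fun _ => none) psi ∧
    X = placementOf (I.slots x lam) psi

end Defs

end SPSC

/-! SA2 derandomizes a rounding of the LP by conditional expectations. In the underlying experiment
each node `j` draws a label with probabilities `labelWeight`, and each slot of class `q` on `j` then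
draws service `i` with probability `x i j / mass`, all independently. `placeProbPartial` and
`satProb` are the resulting conditional probabilities (lower bounds for them where a mass vanishes),
so the value before a choice is at most an average of the values after it, and a maximizing choice
cannot lower it (`labelValue_eq`, `satProb_le_sum_update`). The two objectives agree between the
stages (`slotValue_none`), and at the end the value is at most the reward (`slotValue_le_reward`).

It remains to bound the initial value. The key is that an unlabelled node serves `i` with
probability at least `3/16 * x i j` (`LPFeasible.le_placeProbPartial_none`); the one label matching
the size class of `i` already gives this. Hence user `k` has initial value at least `1 - exp
(-(3/16) r k)`, which by concavity is at least `(1 - exp (-3/16)) * r k`, and `1 - exp (-3/16)`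
exceeds `(1 - exp (-1)) / 4`. The LP value is at least the optimum.

Feasibility does not depend on the maximizers: the slots created on a node have total size at most
its capacity, whatever its label (`sum_slotSize_le`). -/

namespace SPSC

/-! ### Size classes -/

section Fits

variable {S V U : Type*} [Fintype S] {I : SPSC S V U}

theorem mem_fits_large {i : S} {j : V} :
    i ∈ I.fits j .large ↔ 1 / 2 * I.cap j < I.size i ∧ I.size i ≤ I.cap j := by
  simp [fits]

theorem mem_fits_medium {i : S} {j : V} :
    i ∈ I.fits j .medium ↔ I.cap j * beta < I.size i ∧ I.size i ≤ 1 / 2 * I.cap j := by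
  simp [fits]

theorem mem_fits_small {i : S} {j : V} {q : ℕ+} :
    i ∈ I.fits j (.small q) ↔ gamma ^ (q : ℕ) * I.cap j * beta < I.size i ∧
      I.size i ≤ gamma ^ ((q : ℕ) - 1) * I.cap j * beta := by
  simp [fits]

theorem small_unique {i : S} {j : V} {a b : ℕ+} (ha : i ∈ I.fits j (.small a))
    (hb : i ∈ I.fits j (.small b)) : a = b := by
  have key : ∀ a b : ℕ+, a < b → i ∈ I.fits j (.small a) → i ∈ I.fits j (.small b) → False := by
    intro a b hab ha hb
    rw [mem_fits_small] at ha hb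
    have h1 : gamma ^ ((b : ℕ) - 1) ≤ gamma ^ (a : ℕ) :=
      pow_le_pow_of_le_one (by norm_num [gamma]) (by norm_num [gamma])
        (Nat.le_sub_one_of_lt (by exact_mod_cast hab))
    have h2 : gamma ^ ((b : ℕ) - 1) * I.cap j * beta ≤ gamma ^ (a : ℕ) * I.cap j * beta :=
      mul_le_mul_of_nonneg_right (mul_le_mul_of_nonneg_right h1 (I.cap_nonneg j))
        (by norm_num [beta])
    linarith [ha.1, hb.2]
  rcases lt_trichotomy a b with h | h | h
  · exact (key a b h ha hb).elim
  · exact h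
  · exact (key b a h hb ha).elim

theorem mem_smallClasses {i : S} {j : V} {q : ℕ+} (h : i ∈ I.fits j (.small q)) :
    q ∈ I.smallClasses j := by
  simpa [smallClasses] using ⟨i, h⟩

theorem cap_pos_of_fits {i : S} {j : V} {c : SlotClass} (h : i ∈ I.fits j c) : 0 < I.cap j := by
  have hs := I.size_pos i
  refine (I.cap_nonneg j).lt_of_ne fun h0 => ?_
  cases c
  · rw [mem_fits_large, ← h0] at h; linarith
  · rw [mem_fits_medium, ← h0] at h; linarith
  · rw [mem_fits_small, ← h0] at h; simp at h; linarith

theorem size_le_of_fits_small {i : S} {j : V} {q : ℕ+} (h : i ∈ I.fits j (.small q)) :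
    I.size i ≤ I.cap j * beta := by
  refine (mem_fits_small.1 h).2.trans ?_
  have : gamma ^ ((q : ℕ) - 1) ≤ 1 := pow_le_one₀ (by norm_num) (by norm_num)
  have h0 := I.cap_nonneg j
  have := mul_le_mul_of_nonneg_right this h0
  exact mul_le_mul_of_nonneg_right (by linarith) (by norm_num)

theorem exists_fits {i : S} {j : V} (h : I.size i ≤ I.cap j) : ∃ c, i ∈ I.fits j c := by
  have hs := I.size_pos i
  have hc : 0 < I.cap j := hs.trans_le h
  by_cases h1 : 1 / 2 * I.cap j < I.size i
  · exact ⟨.large, mem_fits_large.2 ⟨h1, h⟩⟩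
  by_cases h2 : I.cap j * beta < I.size i
  · exact ⟨.medium, mem_fits_medium.2 ⟨h2, not_lt.1 h1⟩⟩
  push Not at h2
  have hcb : 0 < I.cap j * beta := by norm_num; exact hc
  obtain ⟨n, hn, hn'⟩ := exists_nat_pow_near_of_lt_one (x := I.size i / (I.cap j * beta))
    (y := gamma) (by positivity) ((div_le_one hcb).2 h2) (by norm_num) (by norm_num)
  -- Powers start at `n = 0`, classes at `q = 1`.
  refine ⟨.small n.succPNat, mem_fits_small.2 ⟨?_, ?_⟩⟩
  · rw [lt_div_iff₀ hcb] at hn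
    simpa [mul_assoc] using hn
  · rw [div_le_iff₀ hcb] at hn'
    simpa [mul_assoc] using hn'

end Fits

/-! ### Slots of a node and label probabilities -/

section Slots

variable {S V U : Type*} [Fintype S] [DecidableEq V] (I : SPSC S V U)

/-- The slots created on node `j` if it has label `a`. -/
noncomputable def nodeSlots (x : S → V → ℝ) (j : V) : NodeLabel → Finset (Slot V)
  | .one => {(j, .large, 0)}
  | .two => {(j, .medium, 0), (j, .medium, 1)}
  | .three => (I.smallClasses j).biUnion fun q =>
        (Finset.range (I.smallCount x j q)).image fun t => (j, .small q, t)

variable {I} {x : S → V → ℝ}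

theorem fst_of_mem_nodeSlots {j : V} {a : NodeLabel} {s : Slot V} (h : s ∈ I.nodeSlots x j a) :
    s.1 = j := by
  cases a <;> simp [nodeSlots] at h
  · rw [h]
  · rcases h with h | h <;> rw [h]
  · obtain ⟨q, _, t, _, rfl⟩ := h; rfl

theorem prod_nodeSlots_three {M : Type*} [CommMonoid M] (j : V) (f : Slot V → M) :
    ∏ s ∈ I.nodeSlots x j .three, f s =
      ∏ q ∈ I.smallClasses j, ∏ t ∈ Finset.range (I.smallCount x j q), f (j, .small q, t) := by
  rw [nodeSlots, Finset.prod_biUnion]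
  · refine Finset.prod_congr rfl fun q _ => ?_
    rw [Finset.prod_image]
    intro a _ b _ h
    simpa using h
  · intro q _ q' _ hq
    rw [Function.onFun, Finset.disjoint_left]
    intro s hs hs'
    simp only [Finset.mem_image] at hs hs'
    obtain ⟨t, _, rfl⟩ := hs
    obtain ⟨t', _, h⟩ := hs'
    simp at h
    exact hq h.1.symm

theorem sum_nodeSlots_three {M : Type*} [AddCommMonoid M] (j : V) (f : Slot V → M) :
    ∑ s ∈ I.nodeSlots x j .three, f s =
      ∑ q ∈ I.smallClasses j, ∑ t ∈ Finset.range (I.smallCount x j q), f (j, .small q, t) :=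
  prod_nodeSlots_three (M := Multiplicative M) j f

/-- Service `i` is missed exactly when every slot of its class draws another service. This identity
links the labelling objective to the slot objective. For label `3` only one small class contributes,
by `small_unique`. -/
theorem prod_nodeSlots_eq [DecidableEq S] (i : S) (j : V) (a : NodeLabel) :
    ∏ s ∈ I.nodeSlots x j a with i ∈ I.fits s.1 s.2.1, (1 - x i s.1 / I.mass x s.1 s.2.1) =
      1 - I.placeProb x i j a := by
  rw [Finset.prod_filter]
  cases a
  · simp only [nodeSlots, placeProb, Finset.prod_singleton]
    split_ifs <;> ring
  · simp only [nodeSlots, placeProb]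
    rw [Finset.prod_pair (by simp)]
    simp only
    split_ifs <;> ring
  · rw [prod_nodeSlots_three]
    simp only [placeProb, Finset.prod_const, Finset.card_range]
    by_cases h : ∃ q, i ∈ I.fits j (.small q)
    · obtain ⟨q, hq⟩ := h
      rw [Finset.prod_eq_single_of_mem q (mem_smallClasses hq),
        Finset.sum_eq_single_of_mem q (mem_smallClasses hq)]
      · simp [hq]
      · intro q' _ hne
        exact if_neg fun h => hne (small_unique h hq)
      · intro q' _ hne
        rw [if_neg fun h => hne (small_unique h hq), one_pow]
    · push Not at h
      simp [h]

theorem slots_eq [Fintype V] (lam : V → NodeLabel) :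
    I.slots x lam = Finset.univ.biUnion fun j => I.nodeSlots x j (lam j) := by
  unfold slots
  congr 1

theorem mem_slots [Fintype V] {lam : V → NodeLabel} {s : Slot V} :
    s ∈ I.slots x lam ↔ s ∈ I.nodeSlots x s.1 (lam s.1) := by
  rw [slots_eq]
  simp only [Finset.mem_biUnion, Finset.mem_univ, true_and]
  refine ⟨fun ⟨j, hj⟩ => ?_, fun h => ⟨_, h⟩⟩
  rw [fst_of_mem_nodeSlots hj]; exact hj

end Slots

/-! ### LP mass of a class and drawing probabilities -/

section Mass

variable {S V U : Type*} [Fintype S] {I : SPSC S V U} {x : S → V → ℝ}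

theorem mass_nonneg (hx : ∀ i j, 0 ≤ x i j) (j : V) (c : SlotClass) : 0 ≤ I.mass x j c :=
  Finset.sum_nonneg fun i _ => hx i j

theorem le_mass (hx : ∀ i j, 0 ≤ x i j) {i : S} {j : V} {c : SlotClass} (h : i ∈ I.fits j c) :
    x i j ≤ I.mass x j c :=
  Finset.single_le_sum (f := fun i => x i j) (fun i _ => hx i j) h

theorem ratio_nonneg (hx : ∀ i j, 0 ≤ x i j) (i : S) (j : V) (c : SlotClass) :
    0 ≤ x i j / I.mass x j c := div_nonneg (hx i j) (mass_nonneg hx j c)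

theorem ratio_le_one (hx : ∀ i j, 0 ≤ x i j) {i : S} {j : V} {c : SlotClass}
    (h : i ∈ I.fits j c) : x i j / I.mass x j c ≤ 1 :=
  div_le_one_of_le₀ (le_mass hx h) (mass_nonneg hx j c)

theorem mul_mass_le (hx : ∀ i j, 0 ≤ x i j) {j : V} {c : SlotClass} {b : ℝ}
    (hb : ∀ i ∈ I.fits j c, b ≤ I.size i) :
    I.mass x j c * b ≤ ∑ i ∈ I.fits j c, I.size i * x i j := by
  rw [mass, Finset.sum_mul]
  refine Finset.sum_le_sum fun i hi => ?_
  rw [mul_comm]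
  exact mul_le_mul_of_nonneg_right (hb i hi) (hx i j)

/-- The quotients `x i j / mass` form a distribution unless the mass is `0`. In that case they all
vanish and any distribution dominates them; domination is all that the averaging argument needs. -/
theorem exists_weights [DecidableEq S] (hx : ∀ i j, 0 ≤ x i j) {j : V} {c : SlotClass}
    (hne : (I.fits j c).Nonempty) :
    ∃ p : S → ℝ, (∀ i ∈ I.fits j c, x i j / I.mass x j c ≤ p i) ∧
      (∀ i, 0 ≤ p i) ∧ ∑ i ∈ I.fits j c, p i = 1 := by
  by_cases h : I.mass x j c = 0
  · obtain ⟨i₀, hi₀⟩ := hne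
    refine ⟨fun i => if i = i₀ then 1 else 0, fun i _ => ?_, fun i => ?_, ?_⟩
    · rw [h, div_zero]; dsimp only; split_ifs <;> norm_num
    · dsimp only; split_ifs <;> norm_num
    · simp [hi₀]
  · refine ⟨fun i => x i j / I.mass x j c, fun i _ => le_rfl, fun i => ratio_nonneg hx i j c, ?_⟩
    rw [← Finset.sum_div]
    exact div_self h

variable [DecidableEq S] [DecidableEq V]

theorem placeProb_le_one (hx : ∀ i j, 0 ≤ x i j) (i : S) (j : V) (a : NodeLabel) :
    I.placeProb x i j a ≤ 1 := by
  have : 0 ≤ 1 - I.placeProb x i j a := by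
    rw [← prod_nodeSlots_eq]
    refine Finset.prod_nonneg fun s hs => ?_
    have := ratio_le_one hx (Finset.mem_filter.1 hs).2
    linarith
  linarith

theorem placeProb_nonneg (hx : ∀ i j, 0 ≤ x i j) (i : S) (j : V) (a : NodeLabel) :
    0 ≤ I.placeProb x i j a := by
  have : 1 - I.placeProb x i j a ≤ 1 := by
    rw [← prod_nodeSlots_eq]
    refine Finset.prod_le_one (fun s hs => ?_) fun s hs => ?_
    · have := ratio_le_one hx (Finset.mem_filter.1 hs).2
      linarith
    · have := ratio_nonneg (I := I) hx i s.1 s.2.1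
      linarith
  linarith

end Mass

/-! ### Filling the slots by conditional expectations -/

section Placement

variable {S V U : Type*} [Fintype S] [DecidableEq S] [DecidableEq V]
  {I : SPSC S V U} {x : S → V → ℝ} {L : Finset (Slot V)}

theorem filter_update_eq_erase {t : Slot V → Option S} {s : Slot V} {i : S} {k : U} :
    {s' ∈ L | s'.1 ∈ I.nodes k ∧ Function.update t s (some i) s' = none ∧
      I.service k ∈ I.fits s'.1 s'.2.1} =
    Finset.erase {s' ∈ L | s'.1 ∈ I.nodes k ∧ t s' = none ∧
      I.service k ∈ I.fits s'.1 s'.2.1} s := by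
  ext s'
  by_cases h : s' = s
  · subst h; simp
  · simp [h]

/-- If `s` can serve `k`, let `A` be the product over the other relevant empty slots. Filling `s` at
random from `p` gives `p * 1 + (1 - p) * (1 - A) = 1 - (1 - p) * A` with `p` taken at `service k`,
and this is increasing in `p`. If `k` is already satisfied or `s` is irrelevant to `k`, nothing
changes. -/
theorem satProb_le_sum_update (hx : ∀ i j, 0 ≤ x i j) {t : Slot V → Option S} {s : Slot V}
    (hs : s ∈ L) (hts : t s = none) {p : S → ℝ}
    (hp : ∀ i ∈ I.fits s.1 s.2.1, x i s.1 / I.mass x s.1 s.2.1 ≤ p i)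
    (hp1 : ∑ i ∈ I.fits s.1 s.2.1, p i = 1) (k : U) :
    I.satProb x L t k ≤
      ∑ i ∈ I.fits s.1 s.2.1, p i * I.satProb x L (Function.update t s (some i)) k := by
  by_cases h : ∃ s' ∈ L, s'.1 ∈ I.nodes k ∧ t s' = some (I.service k)
  · have h' : ∀ i, ∃ s' ∈ L, s'.1 ∈ I.nodes k ∧
        Function.update t s (some i) s' = some (I.service k) := by
      intro i
      obtain ⟨s', hs', hk, ht⟩ := h
      refine ⟨s', hs', hk, ?_⟩
      rw [Function.update_of_ne, ht]
      rintro rfl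
      simp [hts] at ht
    simp only [satProb, if_pos h, if_pos (h' _), mul_one, hp1, le_refl]
  have hne : ∀ i, ¬ (s.1 ∈ I.nodes k ∧ i = I.service k) → ¬ ∃ s' ∈ L, s'.1 ∈ I.nodes k ∧
        Function.update t s (some i) s' = some (I.service k) := by
    rintro i hi ⟨s', hs', hk, ht⟩
    by_cases hss : s' = s
    · subst hss
      exact hi ⟨hk, by simpa using ht⟩
    · rw [Function.update_of_ne hss] at ht
      exact h ⟨s', hs', hk, ht⟩
  by_cases hk : s.1 ∈ I.nodes k ∧ I.service k ∈ I.fits s.1 s.2.1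
  · obtain ⟨hk, hf⟩ := hk
    have hmem : s ∈ {s' ∈ L | s'.1 ∈ I.nodes k ∧ t s' = none ∧
        I.service k ∈ I.fits s'.1 s'.2.1} := by simp [hs, hk, hts, hf]
    set A : ℝ := ∏ s' ∈ Finset.erase {s' ∈ L | s'.1 ∈ I.nodes k ∧ t s' = none ∧
        I.service k ∈ I.fits s'.1 s'.2.1} s,
          (1 - x (I.service k) s'.1 / I.mass x s'.1 s'.2.1) with hA
    have hA0 : 0 ≤ A := by
      refine Finset.prod_nonneg fun s' hs' => ?_
      have := ratio_le_one hx (Finset.mem_filter.1 (Finset.mem_of_mem_erase hs')).2.2.2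
      linarith
    have hsat : I.satProb x L t k =
        1 - (1 - x (I.service k) s.1 / I.mass x s.1 s.2.1) * A := by
      rw [satProb, if_neg h, hA, Finset.mul_prod_erase _
        (fun s' : Slot V => 1 - x (I.service k) s'.1 / I.mass x s'.1 s'.2.1) hmem]
    have hterm : ∀ i ∈ I.fits s.1 s.2.1,
        p i * I.satProb x L (Function.update t s (some i)) k =
          p i * (1 - A) + if i = I.service k then p i * A else 0 := by
      intro i _
      split_ifs with hi
      · rw [satProb, if_pos ⟨s, hs, hk, by simp [hi]⟩]; ring
      · rw [satProb, if_neg (hne i fun h => hi h.2), filter_update_eq_erase]; ring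
    rw [Finset.sum_congr rfl hterm, Finset.sum_add_distrib, ← Finset.sum_mul, hp1,
      Finset.sum_ite_eq', if_pos hf, hsat]
    nlinarith [mul_le_mul_of_nonneg_right (hp _ hf) hA0]
  · have hterm : ∀ i ∈ I.fits s.1 s.2.1,
        p i * I.satProb x L (Function.update t s (some i)) k = p i * I.satProb x L t k := by
      intro i hi
      rw [satProb, satProb, if_neg h, if_neg (hne i ?_), filter_update_eq_erase,
        Finset.erase_eq_of_notMem]
      · simp only [Finset.mem_filter]
        rintro ⟨_, h1, _, h2⟩
        exact hk ⟨h1, h2⟩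
      · rintro ⟨h1, rfl⟩
        exact hk ⟨h1, hi⟩
    rw [Finset.sum_congr rfl hterm, ← Finset.sum_mul, hp1, one_mul]

variable [Fintype U]

theorem slotValue_le_update (hx : ∀ i j, 0 ≤ x i j) {t : Slot V → Option S} {s : Slot V}
    (hs : s ∈ L) (hts : t s = none) {i : S} (hi : i ∈ I.fits s.1 s.2.1)
    (hmax : ∀ i' ∈ I.fits s.1 s.2.1, I.slotValue x L (Function.update t s (some i')) ≤
        I.slotValue x L (Function.update t s (some i))) :
    I.slotValue x L t ≤ I.slotValue x L (Function.update t s (some i)) := by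
  obtain ⟨p, hp, hp0, hp1⟩ := exists_weights (I := I) hx ⟨i, hi⟩
  calc I.slotValue x L t
      ≤ ∑ k, (∑ i ∈ I.fits s.1 s.2.1,
          p i * I.satProb x L (Function.update t s (some i)) k) * I.weight k :=
        Finset.sum_le_sum fun k _ => mul_le_mul_of_nonneg_right
          (satProb_le_sum_update hx hs hts hp hp1 k) (I.weight_nonneg k)
    _ = ∑ i ∈ I.fits s.1 s.2.1, p i * I.slotValue x L (Function.update t s (some i)) := by
        simp only [slotValue, Finset.sum_mul, Finset.mul_sum]
        rw [Finset.sum_comm]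
        simp only [mul_assoc]
    _ ≤ ∑ i' ∈ I.fits s.1 s.2.1, p i' * I.slotValue x L (Function.update t s (some i)) :=
        Finset.sum_le_sum fun i' hi' => mul_le_mul_of_nonneg_left (hmax i' hi') (hp0 i')
    _ = _ := by rw [← Finset.sum_mul, hp1, one_mul]

theorem PlaceRun.slotValue_le (hx : ∀ i j, 0 ≤ x i j) {l : List (Slot V)}
    {t t' : Slot V → Option S} (h : I.PlaceRun x L l t t') (hl : l.Nodup)
    (hL : ∀ s ∈ l, s ∈ L) (ht : ∀ s ∈ l, t s = none) :
    I.slotValue x L t ≤ I.slotValue x L t' := by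
  induction h with
  | nil => exact le_rfl
  | skip _ _ ih =>
    rw [List.nodup_cons] at hl
    exact ih hl.2 (fun s hs => hL s (List.mem_cons_of_mem _ hs))
      (fun s hs => ht s (List.mem_cons_of_mem _ hs))
  | fill i hi hmax _ ih =>
    rw [List.nodup_cons] at hl
    refine (slotValue_le_update hx (hL _ List.mem_cons_self) (ht _ List.mem_cons_self)
      hi hmax).trans (ih hl.2 (fun s hs => hL s (List.mem_cons_of_mem _ hs)) fun s hs => ?_)
    rw [Function.update_of_ne (ne_of_mem_of_not_mem hs hl.1)]
    exact ht s (List.mem_cons_of_mem _ hs)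

theorem PlaceRun.fits {l : List (Slot V)} {t t' : Slot V → Option S}
    (h : I.PlaceRun x L l t t') (ht : ∀ s i, t s = some i → i ∈ I.fits s.1 s.2.1) :
    ∀ s i, t' s = some i → i ∈ I.fits s.1 s.2.1 := by
  induction h with
  | nil => exact ht
  | skip _ _ ih => exact ih ht
  | @fill s _ _ _ i hi _ _ ih =>
    refine ih fun s' i' hs' => ?_
    by_cases hss : s' = s
    · subst hss
      simp at hs'
      exact hs' ▸ hi
    · rw [Function.update_of_ne hss] at hs'
      exact ht s' i' hs'

theorem PlaceRun.ne_none {l : List (Slot V)} {t t' : Slot V → Option S}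
    (h : I.PlaceRun x L l t t') {s : Slot V} (hs : t s ≠ none) : t' s ≠ none := by
  induction h with
  | nil => exact hs
  | skip _ _ ih => exact ih hs
  | @fill s' _ _ _ i _ _ _ ih =>
    refine ih ?_
    by_cases hss : s = s'
    · subst hss; simp
    · rwa [Function.update_of_ne hss]

theorem PlaceRun.fits_eq_empty {l : List (Slot V)} {t t' : Slot V → Option S}
    (h : I.PlaceRun x L l t t') : ∀ s ∈ l, t' s = none → I.fits s.1 s.2.1 = ∅ := by
  induction h with
  | nil => simp
  | skip hempty _ ih =>
    intro s hs h0
    rcases List.mem_cons.1 hs with rfl | hs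
    · exact hempty
    · exact ih s hs h0
  | fill i _ _ hrest ih =>
    intro s hs h0
    rcases List.mem_cons.1 hs with rfl | hs
    · exact absurd h0 (hrest.ne_none (by simp))
    · exact ih s hs h0

theorem exists_placeRun (I : SPSC S V U) (x : S → V → ℝ) (L : Finset (Slot V))
    (l : List (Slot V)) (t : Slot V → Option S) : ∃ t', I.PlaceRun x L l t t' := by
  induction l generalizing t with
  | nil => exact ⟨t, .nil t⟩
  | cons s l ih =>
    rcases (I.fits s.1 s.2.1).eq_empty_or_nonempty with h | h
    · obtain ⟨t', ht'⟩ := ih t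
      exact ⟨t', .skip h ht'⟩
    · obtain ⟨i, hi, hmax⟩ := Finset.exists_max_image _
        (fun i => I.slotValue x L (Function.update t s (some i))) h
      obtain ⟨t', ht'⟩ := ih (Function.update t s (some i))
      exact ⟨t', .fill i hi hmax ht'⟩

/-- An empty slot fits no service, so for an unsatisfied user the product is empty and `satProb` is
`0`. -/
theorem slotValue_le_reward [Fintype V] {t : Slot V → Option S}
    (ht : ∀ s ∈ L, t s = none → I.fits s.1 s.2.1 = ∅) :
    I.slotValue x L t ≤ I.reward (placementOf L t) := by
  refine Finset.sum_le_sum fun k _ => ?_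
  by_cases h : ∃ s ∈ L, s.1 ∈ I.nodes k ∧ t s = some (I.service k)
  · rw [satProb, if_pos h, one_mul, if_pos]
    obtain ⟨s, hs, hk, hts⟩ := h
    refine ⟨s.1, Finset.mem_inter.2 ⟨hk, Finset.mem_image.2 ⟨s, ?_, rfl⟩⟩⟩
    simp [hs, hts]
  · rw [satProb, if_neg h, Finset.prod_eq_one, sub_self, zero_mul]
    · split_ifs
      · exact I.weight_nonneg k
      · exact le_rfl
    · intro s hs
      simp only [Finset.mem_filter] at hs
      have := ht s hs.1 hs.2.2.1
      simp [this] at hs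

theorem slotValue_none [Fintype V] (lam : V → NodeLabel) :
    I.slotValue x (I.slots x lam) (fun _ => none) = I.labelValue x (fun j => some (lam j)) := by
  refine Finset.sum_congr rfl fun k _ => ?_
  have h : ¬ ∃ s ∈ I.slots x lam, s.1 ∈ I.nodes k ∧ (none : Option S) = some (I.service k) := by
    simp
  rw [satProb, if_neg h]
  congr 2
  simp only [placeProbPartial, ← prod_nodeSlots_eq, true_and]
  rw [Finset.prod_filter, slots_eq, Finset.prod_biUnion, ← Finset.prod_subset
    (Finset.subset_univ (I.nodes k))]
  · refine Finset.prod_congr rfl fun j hj => ?_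
    rw [Finset.prod_filter]
    refine Finset.prod_congr rfl fun s hs => ?_
    simp [fst_of_mem_nodeSlots hs, hj]
  · intro j _ hj
    refine Finset.prod_eq_one fun s hs => ?_
    simp [fst_of_mem_nodeSlots hs, hj]
  · intro j _ j' _ hne
    rw [Function.onFun, Finset.disjoint_left]
    intro s hs hs'
    exact hne ((fst_of_mem_nodeSlots hs).symm.trans (fst_of_mem_nodeSlots hs'))

end Placement

/-! ### Feasibility: total slot size on a node -/

section Feasibility

variable {S V U : Type*} {I : SPSC S V U} {x : S → V → ℝ}

variable (I) in
/-- The size of the slots of a given class on node `j`. -/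
noncomputable def slotSize (j : V) : SlotClass → ℝ
  | .large => I.cap j
  | .medium => 1 / 2 * I.cap j
  | .small q => gamma ^ ((q : ℕ) - 1) * I.cap j * beta

theorem slotSize_nonneg (j : V) (c : SlotClass) : 0 ≤ I.slotSize j c := by
  have := I.cap_nonneg j
  cases c <;> simp only [slotSize] <;> positivity

variable [Fintype S]

theorem size_le_slotSize {i : S} {j : V} {c : SlotClass} (h : i ∈ I.fits j c) :
    I.size i ≤ I.slotSize j c := by
  cases c
  · exact (mem_fits_large.1 h).2
  · exact (mem_fits_medium.1 h).2
  · exact (mem_fits_small.1 h).2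

theorem sum_gamma_pow_le (s : Finset ℕ+) : ∑ q ∈ s, gamma ^ ((q : ℕ) - 1) ≤ 2 := by
  have h : ∑ q ∈ s, gamma ^ ((q : ℕ) - 1) = ∑ n ∈ s.image PNat.natPred, (1 / 2 : ℝ) ^ n := by
    rw [Finset.sum_image fun a _ b _ h => PNat.natPred_injective h]
    rfl
  rw [h]
  exact (summable_geometric_two.sum_le_tsum _ fun n _ => by positivity).trans_eq
    tsum_geometric_two

theorem sum_small_le [DecidableEq S] (hx : ∀ i j, 0 ≤ x i j) (j : V) :
    ∑ q ∈ I.smallClasses j, ∑ i ∈ I.fits j (.small q), I.size i * x i j ≤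
      ∑ i with I.size i ≤ I.cap j * beta, I.size i * x i j := by
  rw [← Finset.sum_biUnion]
  · refine Finset.sum_le_sum_of_subset_of_nonneg (fun i hi => ?_)
      fun i _ _ => mul_nonneg (I.size_pos i).le (hx i j)
    obtain ⟨q, _, hq⟩ := Finset.mem_biUnion.1 hi
    simpa using size_le_of_fits_small hq
  · intro q _ q' _ hne
    rw [Function.onFun, Finset.disjoint_left]
    exact fun i hi hi' => hne (small_unique hi hi')

theorem scale_nonneg (hx : ∀ i j, 0 ≤ x i j) (j : V) : 0 ≤ I.scale x j :=
  div_nonneg (mul_nonneg (by norm_num) (I.cap_nonneg j))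
    (Finset.sum_nonneg fun i _ => mul_nonneg (I.size_pos i).le (hx i j))

/-- Only an inequality, because the scale is `0` when its denominator is. -/
theorem scale_mul_le (j : V) :
    I.scale x j * ∑ i with I.size i ≤ I.cap j * beta, I.size i * x i j ≤ delta * I.cap j := by
  by_cases h : ∑ i with I.size i ≤ I.cap j * beta, I.size i * x i j = 0
  · rw [h, mul_zero]; exact mul_nonneg (by norm_num) (I.cap_nonneg j)
  · rw [scale, div_mul_cancel₀ _ h]

/-- The capacity splits in two halves: one for the scaled LP masses, one for rounding up, which
costs at most one slot per class and hence a geometric series. -/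
theorem sum_smallCount_le [DecidableEq S] (hx : ∀ i j, 0 ≤ x i j) (j : V) :
    ∑ q ∈ I.smallClasses j, (I.smallCount x j q : ℝ) * I.slotSize j (.small q) ≤ I.cap j := by
  have hv := scale_nonneg (I := I) hx j
  have hc := I.cap_nonneg j
  have hterm : ∀ q ∈ I.smallClasses j, (I.smallCount x j q : ℝ) * I.slotSize j (.small q) ≤
      2 * I.scale x j * ∑ i ∈ I.fits j (.small q), I.size i * x i j +
        I.cap j * beta * gamma ^ ((q : ℕ) - 1) := by
    intro q _
    have h1 : (I.smallCount x j q : ℝ) ≤ I.scale x j * I.mass x j (.small q) + 1 :=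
      (Nat.ceil_lt_add_one (mul_nonneg hv (mass_nonneg hx j _))).le
    have h2 : I.mass x j (.small q) * (gamma ^ (q : ℕ) * I.cap j * beta) ≤
        ∑ i ∈ I.fits j (.small q), I.size i * x i j :=
      mul_mass_le hx fun i hi => (mem_fits_small.1 hi).1.le
    -- Services of class `q` exceed half the slot size; hence the factor `2` in `hterm`.
    have h3 : gamma ^ (q : ℕ) = 1 / 2 * gamma ^ ((q : ℕ) - 1) := by
      rw [← pow_succ', Nat.sub_add_cancel q.pos]
    rw [h3] at h2
    have h4 := mul_le_mul_of_nonneg_left h2 hv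
    have h5 := mul_le_mul_of_nonneg_right h1 (I.slotSize_nonneg j (.small q))
    simp only [slotSize] at h5 ⊢
    generalize ∑ i ∈ I.fits j (.small q), I.size i * x i j = T at h4 ⊢
    generalize gamma ^ ((q : ℕ) - 1) = g at h4 h5 ⊢
    generalize beta = b at h4 h5 ⊢
    linarith
  have h1 := sum_small_le (I := I) hx j
  have h2 := mul_le_mul_of_nonneg_left h1 hv
  have h3 : _ ≤ 1 / 4 * I.cap j := scale_mul_le (I := I) (x := x) j
  have h4 : _ ≤ I.cap j * (1 / 4) * 2 := mul_le_mul_of_nonneg_left (sum_gamma_pow_le (I.smallClasses j))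
    (mul_nonneg hc (by norm_num : (0 : ℝ) ≤ beta))
  refine (Finset.sum_le_sum hterm).trans ?_
  rw [Finset.sum_add_distrib, ← Finset.mul_sum, ← Finset.mul_sum, mul_assoc 2]
  have h5 := mul_le_mul_of_nonneg_left (h2.trans h3) zero_le_two
  exact (add_le_add h5 h4).trans (by linarith)

theorem sum_slotSize_le [DecidableEq S] [DecidableEq V] (hx : ∀ i j, 0 ≤ x i j) (j : V)
    (a : NodeLabel) : ∑ s ∈ I.nodeSlots x j a, I.slotSize s.1 s.2.1 ≤ I.cap j := by
  cases a
  · simp [nodeSlots, slotSize]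
  · rw [nodeSlots, Finset.sum_pair (by simp)]
    simp only [slotSize]
    linarith
  · rw [sum_nodeSlots_three]
    simpa using sum_smallCount_le hx j

theorem feasible_placementOf [Fintype V] [DecidableEq S] [DecidableEq V] (hx : ∀ i j, 0 ≤ x i j)
    {lam : V → NodeLabel} {t : Slot V → Option S}
    (ht : ∀ s i, t s = some i → i ∈ I.fits s.1 s.2.1) :
    I.Feasible (placementOf (I.slots x lam) t) := by
  intro j
  calc ∑ i, (if j ∈ placementOf (I.slots x lam) t i then I.size i else 0)
      ≤ ∑ i, ∑ s ∈ I.nodeSlots x j (lam j), (if t s = some i then I.size i else 0) := by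
        -- A service held by several slots of `j` counts once on the left and once per slot on the
        -- right.
        refine Finset.sum_le_sum fun i _ => ?_
        have h0 : ∀ s ∈ I.nodeSlots x j (lam j), 0 ≤ if t s = some i then I.size i else 0 := by
          intro s _
          split_ifs
          · exact (I.size_pos i).le
          · exact le_rfl
        split_ifs with h
        · simp only [placementOf, Finset.mem_image, Finset.mem_filter] at h
          obtain ⟨s, ⟨hs, hts⟩, rfl⟩ := h
          refine le_trans ?_ (Finset.single_le_sum h0 (mem_slots.1 hs))
          rw [if_pos hts]
        · exact Finset.sum_nonneg h0
    _ = ∑ s ∈ I.nodeSlots x j (lam j), ∑ i, (if t s = some i then I.size i else 0) :=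
        Finset.sum_comm
    _ ≤ ∑ s ∈ I.nodeSlots x j (lam j), I.slotSize s.1 s.2.1 := by
        refine Finset.sum_le_sum fun s _ => ?_
        rcases hts : t s with _ | i
        · simpa using slotSize_nonneg s.1 s.2.1
        · simpa using size_le_slotSize (ht s i hts)
    _ ≤ I.cap j := sum_slotSize_le hx j _

end Feasibility

/-! ### The label distribution of an unlabelled node -/

section Weights

variable {S V U : Type*} [Fintype S] {I : SPSC S V U} {x : S → V → ℝ}

theorem LPFeasible.sum_le {r : U → ℝ} (h : I.LPFeasible x r) (j : V) :
    ∑ i ∈ I.fits j .large, I.size i * x i j + ∑ i ∈ I.fits j .medium, I.size i * x i j +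
      ∑ i with I.size i ≤ I.cap j * beta, I.size i * x i j ≤ I.cap j := by
  refine le_trans ?_ (h.cap j)
  have h0 : ∀ i, 0 ≤ I.size i * x i j := fun i => mul_nonneg (I.size_pos i).le (h.x_nonneg i j)
  have hc := I.cap_nonneg j
  simp only [fits, Finset.sum_filter, ← Finset.sum_add_distrib]
  refine Finset.sum_le_sum fun i _ => ?_
  rw [mul_comm (x i j)]
  have hb : I.cap j * beta = I.cap j / 4 := by norm_num [beta]; ring
  rw [hb]
  split_ifs with h1 h2 h3 h3 h2 h3 h3 <;>
    first
    | (exfalso; linarith [h1.1, h2.2])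
    | (exfalso; linarith [h1.1])
    | (exfalso; linarith [h2.1])
    | linarith [h0 i]

theorem LPFeasible.sum_nonneg {r : U → ℝ} (h : I.LPFeasible x r) (j : V) (s : Finset S) :
    0 ≤ ∑ i ∈ s, I.size i * x i j :=
  Finset.sum_nonneg fun i _ => mul_nonneg (I.size_pos i).le (h.x_nonneg i j)

theorem mass_eq_zero_of_cap {j : V} (hc : I.cap j = 0) (c : SlotClass) : I.mass x j c = 0 := by
  refine Finset.sum_eq_zero fun i hi => ?_
  have := cap_pos_of_fits hi
  linarith

theorem mediumWeight_nonneg (hx : ∀ i j, 0 ≤ x i j) (j : V) : 0 ≤ I.mediumWeight x j := by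
  have := mass_nonneg (I := I) hx j .medium
  rw [mediumWeight]; split_ifs <;> linarith

theorem mediumWeight_le (hx : ∀ i j, 0 ≤ x i j) (j : V) :
    I.mediumWeight x j ≤ I.mass x j .medium := by
  have := mass_nonneg (I := I) hx j .medium
  rw [mediumWeight]; split_ifs <;> linarith

theorem LPFeasible.mass_large {r : U → ℝ} (h : I.LPFeasible x r) (j : V) :
    I.mass x j .large * (1 / 2 * I.cap j) ≤ ∑ i ∈ I.fits j .large, I.size i * x i j :=
  mul_mass_le h.x_nonneg fun _ hi => (mem_fits_large.1 hi).1.le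

theorem LPFeasible.mass_medium {r : U → ℝ} (h : I.LPFeasible x r) (j : V) :
    I.mass x j .medium * (I.cap j * beta) ≤ ∑ i ∈ I.fits j .medium, I.size i * x i j :=
  mul_mass_le h.x_nonneg fun _ hi => (mem_fits_medium.1 hi).1.le

theorem LPFeasible.mass_large_le_two {r : U → ℝ} (h : I.LPFeasible x r) (j : V) :
    I.mass x j .large ≤ 2 := by
  rcases (I.cap_nonneg j).eq_or_lt with hc | hc
  · rw [mass_eq_zero_of_cap hc.symm]; norm_num
  · have h1 := h.mass_large j
    have h2 := h.sum_le j
    have h3 := h.sum_nonneg j (I.fits j .medium)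
    have h4 := h.sum_nonneg j {i | I.size i ≤ I.cap j * beta}
    refine le_of_mul_le_mul_right ?_ hc
    linarith

/-- The medium mass can reach `4`, since medium services exceed a quarter of the capacity; halving
it from `2` on keeps the probability of label `3` nonnegative. -/
theorem LPFeasible.mediumWeight_le_two {r : U → ℝ} (h : I.LPFeasible x r) (j : V) :
    I.mediumWeight x j ≤ 2 := by
  rw [mediumWeight]
  split_ifs with hlt
  · exact hlt.le
  rcases (I.cap_nonneg j).eq_or_lt with hc | hc
  · rw [mass_eq_zero_of_cap hc.symm]; norm_num
  · have h1 := h.mass_medium j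
    have h2 := h.sum_le j
    have h3 := h.sum_nonneg j (I.fits j .large)
    have h4 := h.sum_nonneg j {i | I.size i ≤ I.cap j * beta}
    refine le_of_mul_le_mul_right (a := I.cap j) ?_ hc
    norm_num [beta] at h1 h4 h2
    linarith

variable (I x) in
/-- The probability of each label of an unlabelled node. -/
noncomputable def labelWeight (j : V) : NodeLabel → ℝ
  | .one => delta * I.mass x j .large
  | .two => delta * I.mediumWeight x j
  | .three => 1 - delta * I.mass x j .large - delta * I.mediumWeight x j

theorem LPFeasible.labelWeight_nonneg {r : U → ℝ} (h : I.LPFeasible x r) (j : V) (a : NodeLabel) :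
    0 ≤ I.labelWeight x j a := by
  have h1 := h.mass_large_le_two j
  have h2 := h.mediumWeight_le_two j
  have h3 := mass_nonneg (I := I) h.x_nonneg j .large
  have h4 := mediumWeight_nonneg (I := I) h.x_nonneg j
  cases a <;> norm_num [labelWeight, delta] <;> linarith

theorem labelWeight_sum (j : V) : I.labelWeight x j .one + I.labelWeight x j .two +
    I.labelWeight x j .three = 1 := by simp only [labelWeight]; ring

variable [DecidableEq S]

theorem placeProbPartial_none (i : S) (j : V) :
    I.placeProbPartial x i j none = I.labelWeight x j .one * I.placeProb x i j .one +
      I.labelWeight x j .two * I.placeProb x i j .two +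
      I.labelWeight x j .three * I.placeProb x i j .three := rfl

variable [DecidableEq V]

theorem LPFeasible.placeProbPartial_le_one {r : U → ℝ} (h : I.LPFeasible x r) (i : S) (j : V) :
    I.placeProbPartial x i j none ≤ 1 := by
  rw [placeProbPartial_none, ← labelWeight_sum (I := I) (x := x) j]
  have h1 := fun a => mul_le_of_le_one_right (h.labelWeight_nonneg j a)
    (placeProb_le_one (I := I) h.x_nonneg i j a)
  linarith [h1 .one, h1 .two, h1 .three]

end Weights

/-! ### Labelling by conditional expectations -/

section Labelling

variable {S V U : Type*} [Fintype S] [Fintype U] [DecidableEq S] [DecidableEq V]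
  {I : SPSC S V U} {x : S → V → ℝ}

/-- Each user's term is affine in the factor of node `j`, and an unlabelled node carries the mean of
its three labelled factors. -/
theorem labelValue_eq {z : V → Option NodeLabel} {j : V} (hz : z j = none) :
    I.labelValue x z = I.labelWeight x j .one * I.labelValue x (Function.update z j (some .one)) +
      I.labelWeight x j .two * I.labelValue x (Function.update z j (some .two)) +
      I.labelWeight x j .three * I.labelValue x (Function.update z j (some .three)) := by
  simp only [labelValue, Finset.mul_sum, ← Finset.sum_add_distrib]
  refine Finset.sum_congr rfl fun k _ => ?_
  have hw := labelWeight_sum (I := I) (x := x) j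
  by_cases hj : j ∈ I.nodes k
  · have hup : ∀ a, ∏ j' ∈ I.nodes k, (1 - I.placeProbPartial x (I.service k) j'
        (Function.update z j (some a) j')) = (1 - I.placeProb x (I.service k) j a) *
        ∏ j' ∈ (I.nodes k).erase j, (1 - I.placeProbPartial x (I.service k) j' (z j')) := by
      intro a
      rw [← Finset.mul_prod_erase _ _ hj, Function.update_self]
      congr 1
      refine Finset.prod_congr rfl fun j' hj' => ?_
      rw [Function.update_of_ne (Finset.ne_of_mem_erase hj')]
    rw [hup, hup, hup, ← Finset.mul_prod_erase _ _ hj, hz, placeProbPartial_none]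
    linear_combination (-1 + ∏ j' ∈ (I.nodes k).erase j,
      (1 - I.placeProbPartial x (I.service k) j' (z j'))) * I.weight k * hw
  · have hup : ∀ a, ∏ j' ∈ I.nodes k, (1 - I.placeProbPartial x (I.service k) j'
        (Function.update z j (some a) j')) =
        ∏ j' ∈ I.nodes k, (1 - I.placeProbPartial x (I.service k) j' (z j')) := by
      intro a
      refine Finset.prod_congr rfl fun j' hj' => ?_
      rw [Function.update_of_ne (ne_of_mem_of_not_mem hj' hj)]
    rw [hup, hup, hup]
    linear_combination -((1 - ∏ j' ∈ I.nodes k,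
      (1 - I.placeProbPartial x (I.service k) j' (z j'))) * I.weight k * hw)

theorem LabelRun.labelValue_le {r : U → ℝ} (h : I.LPFeasible x r) {l : List V}
    {z z' : V → Option NodeLabel} (hrun : I.LabelRun x l z z') (hl : l.Nodup)
    (hz : ∀ j ∈ l, z j = none) : I.labelValue x z ≤ I.labelValue x z' := by
  induction hrun with
  | nil => exact le_rfl
  | @cons j l z z' a hmax _ ih =>
    rw [List.nodup_cons] at hl
    refine le_trans ?_ (ih hl.2 fun j' hj' => ?_)
    · rw [labelValue_eq (hz j List.mem_cons_self)]
      have h1 := fun b => mul_le_mul_of_nonneg_left (hmax b) (h.labelWeight_nonneg j b)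
      have h2 := congrArg (· * I.labelValue x (Function.update z j (some a)))
        (labelWeight_sum (I := I) (x := x) j)
      simp only [one_mul] at h2
      linarith [h1 .one, h1 .two, h1 .three]
    · rw [Function.update_of_ne (ne_of_mem_of_not_mem hj' hl.1)]
      exact hz j' (List.mem_cons_of_mem _ hj')

/-- The second conjunct ensures that a run through all nodes ends in a total labelling. -/
theorem exists_labelRun (I : SPSC S V U) (x : S → V → ℝ) (l : List V)
    (z : V → Option NodeLabel) :
    ∃ z', I.LabelRun x l z z' ∧ ∀ j, j ∈ l ∨ z j ≠ none → z' j ≠ none := by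
  induction l generalizing z with
  | nil => exact ⟨z, .nil z, by simp⟩
  | cons j l ih =>
    obtain ⟨a, _, ha⟩ := Finset.exists_max_image ({.one, .two, .three} : Finset NodeLabel)
      (fun b => I.labelValue x (Function.update z j (some b))) (by simp)
    obtain ⟨z', hz', hz⟩ := ih (Function.update z j (some a))
    refine ⟨z', .cons a (fun b => ha b (by cases b <;> simp)) hz', fun j' hj' => hz j' ?_⟩
    by_cases hjj : j' = j
    · subst hjj; simp
    · simpa [hjj] using hj'

end Labelling

/-! ### Numerical inequalities -/

section Bounds

theorem quadratic_div_le_one_sub_exp_neg {t : ℝ} (ht : 0 ≤ t) :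
    (t + t ^ 2 / 2) / (1 + t + t ^ 2 / 2) ≤ 1 - Real.exp (-t) := by
  have h := Real.quadratic_le_exp_of_nonneg ht
  have h0 : 0 < 1 + t + t ^ 2 / 2 := by positivity
  have h1 : Real.exp (-t) ≤ (1 + t + t ^ 2 / 2)⁻¹ := by
    rw [Real.exp_neg]; exact inv_anti₀ h0 h
  have h2 : (t + t ^ 2 / 2) / (1 + t + t ^ 2 / 2) = 1 - (1 + t + t ^ 2 / 2)⁻¹ := by
    field_simp; ring
  linarith

/-- For small classes `F` is the probability of label `3` and `t` the scale. The two lower bounds on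
`F` cross at `t = 1/2`, and each is used on the side where it is the larger. -/
theorem three_sixteenths_le {F t : ℝ} (ht : 0 < t) (h1 : 1 / (4 * t) ≤ F)
    (h2 : 1 / (8 * t) + 1 / 4 ≤ F) : 3 / 16 ≤ F * (1 - Real.exp (-t)) := by
  have hq := quadratic_div_le_one_sub_exp_neg ht.le
  have h0 : 0 < 1 + t + t ^ 2 / 2 := by positivity
  have hF : 0 ≤ F := le_trans (by positivity) h1
  refine le_trans ?_ (mul_le_mul_of_nonneg_left hq hF)
  rcases le_total t (1 / 2) with h | h
  · refine le_trans ?_ (mul_le_mul_of_nonneg_right h1 (by positivity))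
    have : 1 / (4 * t) * ((t + t ^ 2 / 2) / (1 + t + t ^ 2 / 2)) =
        (1 + t / 2) / (4 * (1 + t + t ^ 2 / 2)) := by field_simp
    rw [this, le_div_iff₀ (by positivity)]
    nlinarith
  · refine le_trans ?_ (mul_le_mul_of_nonneg_right h2 (by positivity))
    have : (1 / (8 * t) + 1 / 4) * ((t + t ^ 2 / 2) / (1 + t + t ^ 2 / 2)) =
        (1 + 2 * t) * (1 + t / 2) / (8 * (1 + t + t ^ 2 / 2)) := by field_simp; ring
    rw [this, le_div_iff₀ (by positivity)]
    nlinarith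

/-- Concavity of `1 - exp (-v x)` on the unit interval. -/
theorem mul_one_sub_exp_neg_le {v x : ℝ} (hx0 : 0 ≤ x) (hx1 : x ≤ 1) :
    x * (1 - Real.exp (-v)) ≤ 1 - Real.exp (-(v * x)) := by
  have h := convexOn_exp.2 (Set.mem_univ 0) (Set.mem_univ (-v)) (sub_nonneg.2 hx1) hx0 (by ring)
  simp only [smul_eq_mul, mul_zero, zero_add, Real.exp_zero] at h
  have e : x * -v = -(v * x) := by ring
  rw [e] at h
  linarith

theorem one_sub_exp_neg_one_le : (1 - Real.exp (-1)) / 4 ≤ 1 - Real.exp (-(3 / 16)) := by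
  have h1 := quadratic_div_le_one_sub_exp_neg (t := 3 / 16) (by norm_num)
  have h2 : (0.36 : ℝ) ≤ Real.exp (-1) := by
    rw [Real.exp_neg, le_inv_comm₀ (by norm_num) (Real.exp_pos _)]
    linarith [Real.exp_one_lt_d9]
  norm_num at h1
  linarith

theorem mul_le_one_sub_prod {V : Type*} {s : Finset V} {x p : V → ℝ} {r : ℝ}
    (hp : ∀ j ∈ s, 3 / 16 * x j ≤ p j) (hp1 : ∀ j ∈ s, p j ≤ 1) (hr0 : 0 ≤ r) (hr1 : r ≤ 1)
    (hr : r ≤ ∑ j ∈ s, x j) :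
    (1 - Real.exp (-1)) / 4 * r ≤ 1 - ∏ j ∈ s, (1 - p j) := by
  have h1 : ∏ j ∈ s, (1 - p j) ≤ ∏ j ∈ s, Real.exp (-(3 / 16 * x j)) := by
    refine Finset.prod_le_prod (fun j hj => sub_nonneg.2 (hp1 j hj)) fun j hj => ?_
    have := Real.add_one_le_exp (-(3 / 16 * x j))
    linarith [hp j hj]
  rw [← Real.exp_sum, Finset.sum_neg_distrib, ← Finset.mul_sum] at h1
  have h2 : Real.exp (-(3 / 16 * ∑ j ∈ s, x j)) ≤ Real.exp (-(3 / 16 * r)) :=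
    Real.exp_le_exp.2 (by linarith)
  have h3 := mul_one_sub_exp_neg_le (v := 3 / 16) hr0 hr1
  have h4 := mul_le_mul_of_nonneg_left one_sub_exp_neg_one_le hr0
  linarith

end Bounds

/-! ### The bound `3/16` for each size class -/

section LabelBound

variable {S V U : Type*} [Fintype S] [DecidableEq S] {I : SPSC S V U} {x : S → V → ℝ} {r : U → ℝ}

theorem placeProb_three {i : S} {j : V} {q : ℕ+} (hq : i ∈ I.fits j (.small q)) :
    I.placeProb x i j .three = 1 - (1 - x i j / I.mass x j (.small q)) ^ I.smallCount x j q := by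
  rw [placeProb, Finset.sum_eq_single_of_mem q (mem_smallClasses hq), if_pos hq]
  intro q' _ hne
  exact if_neg fun h => hne (small_unique h hq)

/-- With at least `scale * mass` slots, each drawing `i` with probability `x i j / mass`, the chance
of missing `i` is at most `exp (-scale * x i j)`; concavity in `x i j` finishes. -/
theorem mul_le_placeProb_three (hx : ∀ i j, 0 ≤ x i j) {i : S} {j : V} {q : ℕ+}
    (hx1 : x i j ≤ 1) (hpos : 0 < x i j) (hq : i ∈ I.fits j (.small q)) :
    x i j * (1 - Real.exp (-I.scale x j)) ≤ I.placeProb x i j .three := by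
  refine (mul_one_sub_exp_neg_le hpos.le hx1).trans ?_
  rw [placeProb_three hq, sub_le_sub_iff_left]
  have hm : 0 < I.mass x j (.small q) := hpos.trans_le (le_mass hx hq)
  calc (1 - x i j / I.mass x j (.small q)) ^ I.smallCount x j q
      ≤ Real.exp (-(x i j / I.mass x j (.small q))) ^ I.smallCount x j q := by
        refine pow_le_pow_left₀ (sub_nonneg.2 (ratio_le_one hx hq)) ?_ _
        linarith [Real.add_one_le_exp (-(x i j / I.mass x j (.small q)))]
    _ = Real.exp (-(I.smallCount x j q * (x i j / I.mass x j (.small q)))) := by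
        rw [← Real.exp_nat_mul]; congr 1; ring
    _ ≤ Real.exp (-(I.scale x j * x i j)) := by
        refine Real.exp_le_exp.2 (neg_le_neg ?_)
        calc I.scale x j * x i j
            = I.scale x j * I.mass x j (.small q) * (x i j / I.mass x j (.small q)) := by
              field_simp
          _ ≤ _ := mul_le_mul_of_nonneg_right (Nat.le_ceil _) (ratio_nonneg hx i j _)

theorem LPFeasible.large_bound (h : I.LPFeasible x r) {i : S} {j : V} (hpos : 0 < x i j)
    (hf : i ∈ I.fits j .large) :
    3 / 16 * x i j ≤ I.labelWeight x j .one * I.placeProb x i j .one := by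
  have hm : 0 < I.mass x j .large := hpos.trans_le (le_mass h.x_nonneg hf)
  simp only [labelWeight, placeProb, if_pos hf]
  rw [mul_assoc, mul_div_cancel₀ _ hm.ne']
  norm_num [delta]
  linarith

theorem LPFeasible.medium_bound (h : I.LPFeasible x r) {i : S} {j : V} (hpos : 0 < x i j)
    (hf : i ∈ I.fits j .medium) :
    3 / 16 * x i j ≤ I.labelWeight x j .two * I.placeProb x i j .two := by
  have hle := le_mass h.x_nonneg hf
  have hm : 0 < I.mass x j .medium := hpos.trans_le hle
  have hx1 := h.x_le_one i j
  simp only [labelWeight, placeProb, if_pos hf, mediumWeight]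
  set D := I.mass x j .medium
  set y := x i j
  have hd : delta = (1 / 4 : ℝ) := rfl
  rw [hd]
  split_ifs with h2
  · have e : 1 / 4 * D * (1 - (1 - y / D) ^ 2) = y / 4 * (2 - y / D) := by field_simp; ring
    have h3 : y / D ≤ 1 := (div_le_one hm).2 hle
    rw [e]
    nlinarith
  · push Not at h2
    have e : 1 / 4 * (D / 2) * (1 - (1 - y / D) ^ 2) = y / 8 * (2 - y / D) := by field_simp; ring
    -- This uses `y ≤ 1` and `2 ≤ D`. The bound `y / 8 * (3 / 2)` is where the constant `3/16` comes
    -- from.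
    have h3 : y / D ≤ 1 / 2 := by rw [div_le_iff₀ hm]; linarith
    rw [e]
    nlinarith

theorem LPFeasible.small_bound (h : I.LPFeasible x r) {i : S} {j : V} {q : ℕ+}
    (hpos : 0 < x i j) (hf : i ∈ I.fits j (.small q)) :
    3 / 16 * x i j ≤ I.labelWeight x j .three * I.placeProb x i j .three := by
  have hc := cap_pos_of_fits hf
  have h0 := h.labelWeight_nonneg j .three
  refine le_trans ?_ (mul_le_mul_of_nonneg_left
    (mul_le_placeProb_three h.x_nonneg (h.x_le_one i j) hpos hf) h0)
  suffices h3 : 3 / 16 ≤ I.labelWeight x j .three * (1 - Real.exp (-I.scale x j)) by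
    nlinarith
  have hsum := h.sum_le j
  have hA := h.mass_large j
  have hB := h.mass_medium j
  have hm := mediumWeight_le (I := I) h.x_nonneg j
  have hm2 := h.mediumWeight_le_two j
  have hd := mass_nonneg (I := I) h.x_nonneg j .large
  have hE : 0 < ∑ i with I.size i ≤ I.cap j * beta, I.size i * x i j :=
    Finset.sum_pos' (fun i _ => mul_nonneg (I.size_pos i).le (h.x_nonneg i j))
      ⟨i, by simpa using size_le_of_fits_small hf, mul_pos (I.size_pos i) hpos⟩
  simp only [labelWeight, scale] at h0 ⊢
  generalize ∑ i with I.size i ≤ I.cap j * beta, I.size i * x i j = E at hsum hE ⊢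
  generalize ∑ i ∈ I.fits j .large, I.size i * x i j = A at hsum hA
  generalize ∑ i ∈ I.fits j .medium, I.size i * x i j = B at hsum hB
  generalize I.mass x j .medium = D at hB hm
  generalize I.mass x j .large = d at hA hd h0 ⊢
  generalize I.mediumWeight x j = m at hm hm2 h0 ⊢
  generalize I.cap j = c at hc hsum hA hB ⊢
  have hdel : delta = (1 / 4 : ℝ) := rfl
  have hbet : beta = (1 / 4 : ℝ) := rfl
  rw [hdel] at h0 ⊢
  rw [hbet] at hB
  -- Large and medium services occupy at least `d * c / 2` and `m * c / 4` of the LP capacity. This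
  -- bounds `E / c` by the probability of label `3`; with `m ≤ 2` it also bounds `E / c / 2 + 1 /
  -- 4`.
  have hEG : E ≤ (1 - d / 2 - m / 4) * c := by nlinarith
  have ht : 0 < 1 / 4 * c / E := by positivity
  have hinv : 1 / (4 * (1 / 4 * c / E)) = E / c := by field_simp
  have hinv' : 1 / (8 * (1 / 4 * c / E)) = E / c / 2 := by field_simp; norm_num
  have hEc : E / c ≤ 1 - d / 2 - m / 4 := (div_le_iff₀ hc).2 hEG
  refine three_sixteenths_le ht ?_ ?_
  · rw [hinv]; linarith
  · rw [hinv']; linarith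

theorem LPFeasible.le_placeProbPartial_none [DecidableEq V] (h : I.LPFeasible x r) (i : S)
    (j : V) : 3 / 16 * x i j ≤ I.placeProbPartial x i j none := by
  have h0 := fun a => mul_nonneg (h.labelWeight_nonneg j a)
    (placeProb_nonneg (I := I) h.x_nonneg i j a)
  rw [placeProbPartial_none]
  rcases (h.x_nonneg i j).eq_or_lt with hx | hpos
  · rw [← hx]; linarith [h0 .one, h0 .two, h0 .three]
  obtain ⟨c, hc⟩ := exists_fits (I := I) (i := i) (j := j)
    (not_lt.1 fun hlt => hpos.ne' (h.eq_zero i j hlt))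
  cases c
  · linarith [h0 .two, h0 .three, h.large_bound hpos hc]
  · linarith [h0 .one, h0 .three, h.medium_bound hpos hc]
  · linarith [h0 .two, h0 .one, h.small_bound hpos hc]

theorem LPFeasible.le_labelValue_none [DecidableEq V] [Fintype U] (h : I.LPFeasible x r) :
    (1 - Real.exp (-1)) / 4 * ∑ k, r k * I.weight k ≤ I.labelValue x (fun _ => none) := by
  rw [Finset.mul_sum]
  refine Finset.sum_le_sum fun k _ => ?_
  rw [← mul_assoc]
  exact mul_le_mul_of_nonneg_right (mul_le_one_sub_prod
    (fun j _ => h.le_placeProbPartial_none _ j) (fun j _ => h.placeProbPartial_le_one _ j)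
    (h.r_nonneg k) (h.r_le_one k) (h.r_le_sum k)) (I.weight_nonneg k)

end LabelBound

/-! ### The linear program: relaxation and existence of an optimum -/

section LinearProgram

variable {S V U : Type*} [Fintype S] {I : SPSC S V U}

theorem Feasible.lpFeasible [DecidableEq V] {X : S → Finset V} (h : I.Feasible X) :
    I.LPFeasible (fun i j => if j ∈ X i then 1 else 0)
      (fun k => if (I.nodes k ∩ X (I.service k)).Nonempty then 1 else 0) where
  r_nonneg k := by split_ifs <;> norm_num
  r_le_one k := by split_ifs <;> norm_num
  x_nonneg i j := by split_ifs <;> norm_num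
  x_le_one i j := by split_ifs <;> norm_num
  cap j := by simpa using h j
  -- A service larger than the capacity of `j` would by itself violate feasibility there.
  eq_zero i j hlt := by
    refine if_neg fun hj => (hlt.trans_le ?_).false
    refine le_trans ?_ (h j)
    refine le_trans ?_ (Finset.single_le_sum (fun i _ => ?_) (Finset.mem_univ i))
    · rw [if_pos hj]
    · split_ifs
      · exact (I.size_pos i).le
      · exact le_rfl
  r_le_sum k := by
    split_ifs with hk
    · obtain ⟨j, hj⟩ := hk
      rw [Finset.mem_inter] at hj
      refine le_trans ?_ (Finset.single_le_sum (fun j _ => ?_) hj.1)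
      · rw [if_pos hj.2]
      · split_ifs <;> norm_num
    · exact Finset.sum_nonneg fun j _ => by split_ifs <;> norm_num

theorem LPOptimal.optimum_le [Fintype V] [Fintype U] [DecidableEq V] {x : S → V → ℝ} {r : U → ℝ}
    (h : I.LPOptimal x r) : I.optimum ≤ ∑ k, r k * I.weight k := by
  obtain ⟨X, hX, hopt⟩ := I.isGreatest_optimum.1
  rw [← hopt]
  refine le_trans (le_of_eq ?_) (h.2 _ _ (Feasible.lpFeasible hX))
  simp [reward]

theorem exists_lpOptimal [Fintype V] [Fintype U] (I : SPSC S V U) :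
    ∃ x r, I.LPOptimal x r := by
  let K : Set ((S → V → ℝ) × (U → ℝ)) := {p | I.LPFeasible p.1 p.2}
  have hK : K = {p | (∀ k, 0 ≤ p.2 k) ∧ (∀ k, p.2 k ≤ ∑ j ∈ I.nodes k, p.1 (I.service k) j) ∧
      (∀ k, p.2 k ≤ 1) ∧ (∀ j, ∑ i, p.1 i j * I.size i ≤ I.cap j) ∧
      (∀ i j, I.cap j < I.size i → p.1 i j = 0) ∧ (∀ i j, 0 ≤ p.1 i j) ∧
      (∀ i j, p.1 i j ≤ 1)} := by
    ext p
    exact ⟨fun ⟨a, b, c, d, e, f, g⟩ => ⟨a, b, c, d, e, f, g⟩,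
      fun ⟨a, b, c, d, e, f, g⟩ => ⟨a, b, c, d, e, f, g⟩⟩
  have hclosed : IsClosed K := by
    rw [hK]
    simp only [Set.ofPred_and, Set.ofPred_forall]
    refine (isClosed_iInter fun k => isClosed_le (by fun_prop) (by fun_prop)).inter
      ((isClosed_iInter fun k => isClosed_le (by fun_prop) (by fun_prop)).inter
      ((isClosed_iInter fun k => isClosed_le (by fun_prop) (by fun_prop)).inter
      ((isClosed_iInter fun j => isClosed_le (by fun_prop) (by fun_prop)).inter
      ((isClosed_iInter fun i => isClosed_iInter fun j => isClosed_iInter fun _ =>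
        isClosed_eq (by fun_prop) continuous_const).inter
      ((isClosed_iInter fun i => isClosed_iInter fun j =>
        isClosed_le (by fun_prop) (by fun_prop)).inter
      (isClosed_iInter fun i => isClosed_iInter fun j =>
        isClosed_le (by fun_prop) (by fun_prop)))))))
  have hcomp : IsCompact K := by
    refine (isCompact_Icc (a := (0 : (S → V → ℝ) × (U → ℝ))) (b := 1)).of_isClosed_subset
      hclosed fun p hp => ?_
    exact ⟨⟨hp.x_nonneg, hp.r_nonneg⟩, ⟨hp.x_le_one, hp.r_le_one⟩⟩
  have hne : K.Nonempty := ⟨0, by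
    constructor <;> simp [I.cap_nonneg]⟩
  obtain ⟨p, hp, hmax⟩ := hcomp.exists_isMaxOn hne
    (f := fun p => ∑ k, p.2 k * I.weight k) (by fun_prop)
  exact ⟨p.1, p.2, hp, fun x' r' h' => hmax (a := (x', r')) h'⟩

end LinearProgram

end SPSC

/-! ### Existence of an output and its guarantee -/

theorem mainTheorem1 {S V U : Type*} [Fintype S] [Fintype V] [Fintype U]
    [DecidableEq S] [DecidableEq V] (I : SPSC S V U) :
    (∃ X : S → Finset V, I.IsSA2Output X) ∧
      ∀ X : S → Finset V, I.IsSA2Output X →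
        I.Feasible X ∧ (1 - Real.exp (-1)) / 4 * I.optimum ≤ I.reward X := by
  constructor
  · obtain ⟨x, r, hopt⟩ := I.exists_lpOptimal
    obtain ⟨z, hz, hsome⟩ := I.exists_labelRun x Finset.univ.toList (fun _ => none)
    have hsome' : ∀ j, ∃ a, z j = some a := fun j =>
      Option.ne_none_iff_exists'.1 (hsome j (Or.inl (by simp)))
    choose lam hlam using hsome'
    obtain rfl : z = fun j => some (lam j) := funext hlam
    obtain ⟨psi, hpsi⟩ := I.exists_placeRun x (I.slots x lam) (I.slots x lam).toList
      (fun _ => none)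
    exact ⟨_, x, r, Finset.univ.toList, lam, (I.slots x lam).toList, psi, hopt,
      Finset.nodup_toList _, by simp, hz, Finset.nodup_toList _, by simp, hpsi, rfl⟩
  · rintro X ⟨x, r, nodeOrder, lam, slotOrder, psi, hopt, hnd, -, hlab, hnd', hslots, hplace, rfl⟩
    have hx := hopt.1.x_nonneg
    refine ⟨SPSC.feasible_placementOf hx (hplace.fits (by simp)), ?_⟩
    have hc : 0 ≤ (1 - Real.exp (-1)) / 4 := by
      have : Real.exp (-1) ≤ 1 := Real.exp_le_one_iff.2 (by norm_num)
      linarith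
    calc (1 - Real.exp (-1)) / 4 * I.optimum
        ≤ (1 - Real.exp (-1)) / 4 * ∑ k, r k * I.weight k :=
          mul_le_mul_of_nonneg_left hopt.optimum_le hc
      _ ≤ I.labelValue x (fun _ => none) := hopt.1.le_labelValue_none
      _ ≤ I.labelValue x (fun j => some (lam j)) :=
          hlab.labelValue_le hopt.1 hnd (by simp)
      _ = I.slotValue x (I.slots x lam) (fun _ => none) := (SPSC.slotValue_none lam).symm
      _ ≤ I.slotValue x (I.slots x lam) psi :=
          hplace.slotValue_le hx hnd' (fun s hs => (hslots s).1 hs) (by simp)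
      _ ≤ _ := SPSC.slotValue_le_reward fun s hs =>
          hplace.fits_eq_empty s ((hslots s).2 hs)
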